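/- Fix a field $\mathbb{k}$. A *filtration* $\mathcal F$ consists of a finite abstract simplicial complex $K$ together with a function $w:K\to\mathbb R$ such that $w(\tau)\le w(\tau')$ whenever $\tau\subseteq\tau'$ (ties are allowed); its complex at time $t\in\mathbb R$ is $X_t=\{\tau\in K: w(\tau)\le t\}$. For an integer $k\ge 0$, $\mathrm{PH}_k(\mathcal F)$ is the persistence module formed by the reduced simplicial homology spaces $\mathrm H_k(X_t;\mathbb k)$, $t\in\mathbb R$, with the maps induced by the inclusions $X_s\subseteq X_t$, $s\le t$. The persistence diagram $\mathrm{dgm}_k(\mathcal F)$ is the finite multiset of pairs $(b_i,d_i)$, with $b_i\in\mathbb R$, $d_i\in\mathbb R\cup\{\infty\}$ and $b_i<d_i$, for which $\mathrm{PH}_k(\mathcal F)\cong\bigoplus_i\mathbb I[b_i,d_i)$, where $\mathbb I[b,d)$ is the interval module that is $\mathbb k$ with identity maps over $[b,d)$ and zero elsewhere. For $\alpha\in(1,\infty)$ let $\Pi_k(\alpha;\mathcal F)$ be the number of $\alpha$-persistent $k$-cycles, that is, the number of points $(b,d)\in\mathrm{dgm}_k(\mathcal F)$, counted with multiplicity,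 with $d/b\ge\alpha$ (with the convention $d/b=\infty$ if $b=0$). **Lemma.** Let $\mathcal F=(K,w)$ be a filtration, let $\sigma\notin K$ be a simplex, and let $\mathcal F\cup\sigma=(K\cup\{\sigma\},w')$ be a filtration with $w'|_K=w$. Let $k\ge 0$ and $\alpha\in(1,\infty)$. Then both diagrams $\mathrm{dgm}_k(\mathcal F)$ and $\mathrm{dgm}_k(\mathcal F\cup\sigma)$ exist, and for any interval decompositions defining them the following holds. If $\dim\sigma\in\{k,k+1\}$, then $$\Pi_k(\alpha;\mathcal F)-1\le\Pi_k(\alpha;\mathcal F\cup\sigma)\le\Pi_k(\alpha;\mathcal F)+1 .$$ Otherwise, that is, if $\dim\sigma\notin\{k,k+1\}$, then $$\Pi_k(\alpha;\mathcal F\cup\sigma)=\Pi_k(\alpha;\mathcal F).$$ -/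

import Mathlib

set_option maxSynthPendingDepth 3

open scoped DirectSum

namespace PersistentCycles

universe u v w

/-! ### Filtered simplicial complexes -/

/-- A filtration of a finite abstract simplicial complex, given by its filtration value function:
the simplex `s` joins the complex at time `time s`, and no simplex joins before its faces.
The values of `time` outside the complex are irrelevant. Ties are allowed. -/
structure Filtration (V : Type v) where
  /-- the final complex -/
  complex : PreAbstractSimplicialComplex V
  /-- there are finitely many simplices -/
  finite : complex.faces.Finite
  /-- the time at which a simplex joins -/
  time : Finset V → ℝ
  /-- faces join no later than their cofaces -/
  time_mono : ∀ s ∈ complex, ∀ t ∈ complex, s ⊆ t → time s ≤ time t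

/-- The complex `X_t` of all simplices that have joined by time `t`. -/
def Filtration.sublevel {V : Type v} (F : Filtration V) (t : ℝ) :
    PreAbstractSimplicialComplex V where
  faces := {s | s ∈ F.complex ∧ F.time s ≤ t}
  isRelLowerSet_faces := by
    rintro s ⟨hs, hst⟩
    obtain ⟨hne, hlow⟩ := F.complex.isRelLowerSet_faces hs
    exact ⟨hne, fun r hr hrne =>
      ⟨hlow hr hrne, (F.time_mono r (hlow hr hrne) s hs hr).trans hst⟩⟩

theorem Filtration.sublevel_mono {V : Type v} (F : Filtration V) {s t : ℝ} (h : s ≤ t) :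
    F.sublevel s ≤ F.sublevel t :=
  fun _ hx => ⟨hx.1, hx.2.trans h⟩

/-- `F'` is a filtration obtained from `F` by adding the single simplex `σ`, which is not in `F`,
at some time; the simplices of `F` keep their times. That `F'` is a valid filtration is part of
its type. -/
structure Filtration.IsAddition {V : Type v} (F : Filtration V) (σ : Finset V)
    (F' : Filtration V) : Prop where
  notMem : σ ∉ F.complex
  faces_eq : F'.complex.faces = insert σ F.complex.faces
  time_eq : ∀ s ∈ F.complex, F'.time s = F.time s

/-- The dimension of a simplex is its number of vertices minus one. -/
def simplexDim {V : Type v} (s : Finset V) : ℤ := (s.card : ℤ) - 1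

/-! ### Reduced simplicial homology -/

section Homology

variable (𝕜 : Type u) [Field 𝕜] {V : Type v} [LinearOrder V]

/-- The simplicial boundary operator on formal combinations of finite sets,
`∂[v₀ < ⋯ < vₖ] = ∑ᵢ (-1)ⁱ [v₀, …, v̂ᵢ, …, vₖ]`. The boundary of a vertex is the empty simplex,
so this is the augmented (reduced) boundary operator. -/
noncomputable def boundary : (Finset V →₀ 𝕜) →ₗ[𝕜] (Finset V →₀ 𝕜) :=
  Finsupp.linearCombination 𝕜 fun s : Finset V =>
    ∑ v ∈ s, Finsupp.single (s.erase v) ((-1 : 𝕜) ^ (s.filter (· < v)).card)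

/-- The `k`-chains of `K`: combinations of `k`-simplices of `K` (those with `k + 1` vertices). -/
noncomputable def chains (K : PreAbstractSimplicialComplex V) (k : ℕ) :
    Submodule 𝕜 (Finset V →₀ 𝕜) :=
  Finsupp.supported 𝕜 𝕜 {s | s ∈ K ∧ s.card = k + 1}

/-- The (reduced) `k`-cycles of `K`. -/
noncomputable def cycles (K : PreAbstractSimplicialComplex V) (k : ℕ) :
    Submodule 𝕜 (Finset V →₀ 𝕜) :=
  chains 𝕜 K k ⊓ LinearMap.ker (boundary 𝕜)

/-- The `k`-boundaries of `K`. -/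
noncomputable def boundaries (K : PreAbstractSimplicialComplex V) (k : ℕ) :
    Submodule 𝕜 (Finset V →₀ 𝕜) :=
  (chains 𝕜 K (k + 1)).map (boundary 𝕜)

/-- The reduced homology `H_k(K) = Z_k(K) / B_k(K)` with coefficients in `𝕜`. -/
abbrev Homology (K : PreAbstractSimplicialComplex V) (k : ℕ) : Type (max u v) :=
  cycles 𝕜 K k ⧸ (boundaries 𝕜 K k).submoduleOf (cycles 𝕜 K k)

variable {𝕜}

theorem chains_mono {K L : PreAbstractSimplicialComplex V} (h : K ≤ L) (k : ℕ) :
    chains 𝕜 K k ≤ chains 𝕜 L k :=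
  Finsupp.supported_mono fun _ hs => ⟨h hs.1, hs.2⟩

theorem cycles_mono {K L : PreAbstractSimplicialComplex V} (h : K ≤ L) (k : ℕ) :
    cycles 𝕜 K k ≤ cycles 𝕜 L k :=
  inf_le_inf_right _ (chains_mono h k)

theorem boundaries_mono {K L : PreAbstractSimplicialComplex V} (h : K ≤ L) (k : ℕ) :
    boundaries 𝕜 K k ≤ boundaries 𝕜 L k :=
  Submodule.map_mono (chains_mono h (k + 1))

theorem boundary_single (s : Finset V) (a : 𝕜) :
    boundary 𝕜 (Finsupp.single s a) =
      ∑ v ∈ s, Finsupp.single (s.erase v) (a * (-1) ^ (s.filter (· < v)).card) := by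
  simp [boundary, Finsupp.linearCombination_single, Finset.smul_sum]

theorem boundary_boundary (c : Finset V →₀ 𝕜) : boundary 𝕜 (boundary 𝕜 c) = 0 := by
  induction c using Finsupp.induction_linear with
  | zero => simp
  | add x y hx hy => simp [hx, hy]
  | single s a =>
    have key : ∀ u ∈ s, ∀ v ∈ s, u < v →
        ((-1 : 𝕜) ^ (s.filter (· < v)).card * (-1) ^ ((s.erase v).filter (· < u)).card) +
        ((-1) ^ (s.filter (· < u)).card * (-1) ^ ((s.erase u).filter (· < v)).card) = 0 := by
      intro u hu v hv huv
      have h1 : (s.erase v).filter (· < u) = s.filter (· < u) := by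
        ext x; simp only [Finset.mem_filter, Finset.mem_erase]
        exact ⟨fun h => ⟨h.1.2, h.2⟩, fun h => ⟨⟨(h.2.trans huv).ne, h.1⟩, h.2⟩⟩
      have h2 : (s.erase u).filter (· < v) = (s.filter (· < v)).erase u := by
        ext x; simp only [Finset.mem_filter, Finset.mem_erase]; tauto
      have h3 : (s.filter (· < v)).card = ((s.filter (· < v)).erase u).card + 1 :=
        (Finset.card_erase_add_one (Finset.mem_filter.2 ⟨hu, huv⟩)).symm
      rw [h1, h2, h3, pow_succ]; ring
    simp only [boundary_single, map_sum]
    rw [Finset.sum_sigma']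
    refine Finset.sum_involution (fun p _ => ⟨p.2, p.1⟩) ?_ ?_ ?_ ?_
    · rintro ⟨v, u⟩ h
      simp only [Finset.mem_sigma, Finset.mem_erase] at h
      rw [Finset.erase_right_comm (a := u) (b := v), ← Finsupp.single_add, mul_assoc, mul_assoc,
        ← mul_add]
      rcases lt_or_gt_of_ne h.2.1 with huv | huv
      · rw [key u h.2.2 v h.1 huv]; simp
      · rw [add_comm, key v h.1 u h.2.2 huv]; simp
    · rintro ⟨v, u⟩ h _ he
      simp only [Finset.mem_sigma, Finset.mem_erase] at h
      simp only [Sigma.mk.injEq] at he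
      exact h.2.1 he.1
    · rintro ⟨v, u⟩ h
      simp only [Finset.mem_sigma, Finset.mem_erase] at h ⊢
      exact ⟨h.2.2, h.2.1.symm, h.1⟩
    · rintro ⟨v, u⟩ _; rfl

theorem boundaries_le_cycles (K : PreAbstractSimplicialComplex V) (k : ℕ) :
    boundaries 𝕜 K k ≤ cycles 𝕜 K k := by
  rintro _ ⟨c, hc, rfl⟩
  refine ⟨?_, boundary_boundary c⟩
  rw [boundary, Finsupp.linearCombination_apply]
  refine Submodule.sum_mem _ fun s hs => Submodule.smul_mem _ _ (Submodule.sum_mem _ fun v hv => ?_)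
  have hsK := (Finsupp.mem_supported 𝕜 c).1 hc hs
  refine Finsupp.single_mem_supported 𝕜 _ ⟨?_, ?_⟩
  · have hcard : (s.erase v).card = k + 1 := by rw [Finset.card_erase_of_mem hv, hsK.2]; rfl
    exact (K.isRelLowerSet_faces hsK.1).2 (Finset.erase_subset _ _)
      (Finset.card_pos.1 (by omega))
  · rw [Finset.card_erase_of_mem hv, hsK.2]; rfl
/-- The map on homology induced by an inclusion of complexes. -/
noncomputable def homologyMap {K L : PreAbstractSimplicialComplex V} (h : K ≤ L) (k : ℕ) :
    Homology 𝕜 K k →ₗ[𝕜] Homology 𝕜 L k :=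
  Submodule.mapQ _ _ (Submodule.inclusion (cycles_mono h k)) fun _ hx =>
    boundaries_mono h k hx

end Homology

/-! ### Persistence modules and their diagrams -/

/-- A persistence module over `ℝ`: a functor from the ordered set `ℝ` to vector spaces. -/
structure PersistenceModule (𝕜 : Type u) [Field 𝕜] where
  /-- the vector space at time `t` -/
  obj : ℝ → Type w
  [addCommGroup : ∀ t, AddCommGroup (obj t)]
  [module : ∀ t, Module 𝕜 (obj t)]
  /-- the structure maps -/
  map : ∀ {s t : ℝ}, s ≤ t → obj s →ₗ[𝕜] obj t
  map_refl : ∀ (t : ℝ) (x : obj t), map (le_refl t) x = x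
  map_trans : ∀ {r s t : ℝ} (hrs : r ≤ s) (hst : s ≤ t) (x : obj r),
    map hst (map hrs x) = map (hrs.trans hst) x

attribute [instance] PersistenceModule.addCommGroup PersistenceModule.module

/-- An isomorphism of persistence modules: linear isomorphisms commuting with the structure
maps. -/
structure PersistenceModule.Iso {𝕜 : Type u} [Field 𝕜] (M : PersistenceModule.{u, v} 𝕜)
    (N : PersistenceModule.{u, w} 𝕜) where
  /-- the isomorphism at time `t` -/
  equiv : ∀ t, M.obj t ≃ₗ[𝕜] N.obj t
  naturality : ∀ {s t : ℝ} (h : s ≤ t) (x : M.obj s),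
    equiv t (M.map h x) = N.map h (equiv s x)

/-- The persistent homology module `PH_k(F)`: the reduced homology spaces of the complexes of the
filtration, with the maps induced by the inclusions. -/
noncomputable def persistentHomology (𝕜 : Type u) [Field 𝕜] {V : Type v} [LinearOrder V]
    (F : Filtration V) (k : ℕ) : PersistenceModule.{u, max u v} 𝕜 where
  obj t := Homology 𝕜 (F.sublevel t) k
  map h := homologyMap (F.sublevel_mono h) k
  map_refl _ x := by
    obtain ⟨x, rfl⟩ := Submodule.Quotient.mk_surjective _ x
    rfl
  map_trans _ _ x := by
    obtain ⟨x, rfl⟩ := Submodule.Quotient.mk_surjective _ x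
    rfl

/-- The space of the interval module at time `t`: all of `𝕜` if `b ≤ t < d`, and zero
otherwise. -/
def intervalSpace (𝕜 : Type u) [Field 𝕜] (b : ℝ) (d : EReal) (t : ℝ) : Submodule 𝕜 𝕜 where
  carrier := {x | (b ≤ t ∧ (t : EReal) < d) ∨ x = 0}
  zero_mem' := Or.inr rfl
  add_mem' := by
    rintro x y (h | rfl) (h' | rfl)
    · exact Or.inl h
    · exact Or.inl h
    · exact Or.inl h'
    · exact Or.inr (add_zero 0)
  smul_mem' := by
    rintro c x (h | rfl)
    · exact Or.inl h
    · exact Or.inr (smul_zero c)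

theorem intervalSpace_le {𝕜 : Type u} [Field 𝕜] {b : ℝ} {d : EReal} {s t : ℝ} (hst : s ≤ t)
    (ht : (t : EReal) < d) : intervalSpace 𝕜 b d s ≤ intervalSpace 𝕜 b d t := by
  rintro x (h | rfl)
  · exact Or.inl ⟨h.1.trans hst, ht⟩
  · exact Or.inr rfl

open Classical in
/-- The interval module `𝕀[b,d)`: one-dimensional with identity structure maps over `[b,d)`, and
zero elsewhere. -/
noncomputable def intervalModule (𝕜 : Type u) [Field 𝕜] (b : ℝ) (d : EReal) :
    PersistenceModule.{u, u} 𝕜 where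
  obj t := intervalSpace 𝕜 b d t
  map {_ t} h := if ht : (t : EReal) < d then Submodule.inclusion (intervalSpace_le h ht) else 0
  map_refl t x := by
    obtain ⟨x, hx⟩ := x
    split_ifs with ht
    · rfl
    · rcases hx with hx | rfl
      · exact absurd hx.2 ht
      · rfl
  map_trans {r s t} hrs hst x := by
    by_cases ht : (t : EReal) < d
    · have hs : (s : EReal) < d := (EReal.coe_le_coe_iff.2 hst).trans_lt ht
      simp only [ht, hs, dite_true]
      rfl
    · simp only [ht, dite_false, LinearMap.zero_apply]

/-- The direct sum of a family of persistence modules. -/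
noncomputable def PersistenceModule.directSum {𝕜 : Type u} [Field 𝕜] {ι : Type v}
    (M : ι → PersistenceModule.{u, w} 𝕜) : PersistenceModule.{u, max v w} 𝕜 where
  obj t := ⨁ i, (M i).obj t
  map h := DirectSum.lmap fun i => (M i).map h
  map_refl t x := by
    refine DirectSum.ext_component 𝕜 fun i => ?_
    exact (M i).map_refl t (x i)
  map_trans hrs hst x := by
    refine DirectSum.ext_component 𝕜 fun i => ?_
    exact (M i).map_trans hrs hst (x i)

/-- `D` is the persistence diagram of `M`: the finite multiset of the pairs `(bᵢ, dᵢ)`, with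
`bᵢ < dᵢ ≤ ∞`, of a decomposition `M ≅ ⨁ᵢ 𝕀[bᵢ,dᵢ)`. -/
def IsDiagram {𝕜 : Type u} [Field 𝕜] (M : PersistenceModule.{u, w} 𝕜)
    (D : Multiset (ℝ × EReal)) : Prop :=
  ∃ (n : ℕ) (b : Fin n → ℝ) (d : Fin n → EReal),
    (∀ i, (b i : EReal) < d i) ∧
    Nonempty (M.Iso (PersistenceModule.directSum fun i => intervalModule 𝕜 (b i) (d i))) ∧
    D = (Finset.univ : Finset (Fin n)).val.map fun i => (b i, d i)

/-! ### Counting `α`-persistent cycles -/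

/-- The ratio `death / birth` of a point of a diagram, with value `∞` if the birth time is `0`. -/
noncomputable def piValue (p : ℝ × EReal) : EReal :=
  if p.1 = 0 then ⊤ else p.2 / (p.1 : EReal)

open Classical in
/-- The number of points of the diagram, with multiplicity, whose ratio is at least `α`. -/
noncomputable def persistentCount (α : ℝ) (D : Multiset (ℝ × EReal)) : ℕ :=
  D.countP fun p => (α : EReal) ≤ piValue p

end PersistentCycles

/-!
Write `Z t` and `B t` for the `k`-cycles and the `k`-boundaries at time `t`, which are increasing
families of subspaces of the space of chains.

*Existence of diagrams.* Two chains of subspaces of a finite-dimensional space have a common adapted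
basis (`exists_adapted_basis`). For the chains `Z` and `B`, its vectors that lie in `Z t` but not in
`B t` form a basis of the homology at time `t`, so each basis vector spans an interval summand
(`exists_isDiagram`).

*Comparison of the counts.* In any barcode, the number of intervals that contain both `a` and `t`
is the rank of the structure map from `a` to `t`, which equals `dim Z a - dim (Z a ∩ B t)`
(`rankCount_add_finrank`). An `α`-persistent interval has a birth `β ≥ 0` and a death at least
`α * β`, so the number of those born at `β` is the difference of the ranks of the maps from `β` and
from just before `β` to a time just before `α * β`. Summing over `β` expresses the count through
the rank function, for any decomposition.

Adding `σ` changes the rank from `a` to `t` by the indicator of a relation `P a t`. If `dim σ = k`,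
then `P a t` says that there is a new cycle at time `a`, independently of `t`. If `dim σ = k + 1`,
then `P a t` says that some element of `Z a` is a boundary at time `t` only thanks to `σ`; such an
element can replace `∂σ` at all later times `t'`, so that `P a t'` follows from `P a t` as long as
the boundaries at time `t'` depend on `σ` at all. In both cases the differences contributed by the
various `β` all have the same sign, and at most one is nonzero (`persistentCount_of_rankCount`). In
the remaining dimensions neither cycles nor boundaries change.
-/

namespace PersistentCycles

open Module

universe u v w

/-! ### Bases adapted to two chains of subspaces -/

theorem finrank_comap_subtype {𝕜 E : Type*} [Field 𝕜] [AddCommGroup E] [Module 𝕜 E]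
    (W P : Submodule 𝕜 E) : finrank 𝕜 ↥(P.comap W.subtype) = finrank 𝕜 ↥(W ⊓ P) := by
  rw [← Submodule.map_comap_subtype]
  exact (Submodule.equivMapOfInjective W.subtype W.injective_subtype _).finrank_eq

/-- A linear functional that does not vanish on `W` cuts out a hyperplane of `W`. -/
theorem finrank_inf_ker_add_one {𝕜 E : Type*} [Field 𝕜] [AddCommGroup E] [Module 𝕜 E]
    (W : Submodule 𝕜 E) [FiniteDimensional 𝕜 W] (φ : E →ₗ[𝕜] 𝕜) (h : ¬ W ≤ LinearMap.ker φ) :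
    finrank 𝕜 ↥(W ⊓ LinearMap.ker φ) + 1 = finrank 𝕜 W := by
  obtain ⟨w, hw, hφ⟩ := SetLike.not_le_iff_exists.1 h
  have h1 := (φ.domRestrict W).finrank_range_add_finrank_ker
  have h2 : LinearMap.range (φ.domRestrict W) = ⊤ := by
    refine LinearMap.range_eq_top.2 (LinearMap.surjective fun h0 => hφ ?_)
    exact LinearMap.mem_ker.2 (LinearMap.congr_fun h0 ⟨w, hw⟩)
  rw [h2, finrank_top, finrank_self, LinearMap.ker_domRestrict, finrank_comap_subtype] at h1
  rw [← h1, add_comm]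

/-- Two chains of subspaces of a finite-dimensional space have a common adapted basis: every
member of either chain is spanned by the basis vectors it contains. The proof is by induction on
the dimension: a hyperplane containing all proper members of the first chain inherits such a basis,
and the missing vector is taken from the smallest member of the second chain that leaves the
hyperplane. -/
theorem exists_adapted_basis {𝕜 E : Type*} [Field 𝕜] [AddCommGroup E] [Module 𝕜 E]
    (W : Submodule 𝕜 E) [FiniteDimensional 𝕜 W] (A B : Set (Submodule 𝕜 E))
    (hA : IsChain (· ≤ ·) A) (hB : IsChain (· ≤ ·) B)
    (hAW : ∀ U ∈ A, U ≤ W) (hBW : ∀ U ∈ B, U ≤ W) :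
    ∃ s : Set E, LinearIndepOn 𝕜 id s ∧ Submodule.span 𝕜 s = W ∧
      (∀ U ∈ A, Submodule.span 𝕜 (s ∩ U) = U) ∧ ∀ U ∈ B, Submodule.span 𝕜 (s ∩ U) = U := by
  induction hn : finrank 𝕜 W generalizing W A B with
  | zero =>
    have hW : W = ⊥ := Submodule.finrank_eq_zero.1 hn
    subst hW
    refine ⟨∅, linearIndepOn_empty _ _, by simp, fun U hU => ?_, fun U hU => ?_⟩
    · simpa using (le_bot_iff.1 (hAW U hU)).symm
    · simpa using (le_bot_iff.1 (hBW U hU)).symm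
  | succ n ih =>
    -- The union of the members of `A` other than `W` is a proper subspace, since it is itself
    -- `⊥` or a member of `A`.
    obtain ⟨Z, hZW, hAZ⟩ : ∃ Z : Submodule 𝕜 E, Z < W ∧ ∀ U ∈ A, U ≠ W → U ≤ Z := by
      by_cases hne : ∃ U ∈ A, U ≠ W
      · obtain ⟨U₀, hU₀, hUW₀⟩ := hne
        obtain ⟨U, ⟨hU, hUW⟩, hmax⟩ := WellFounded.has_min
          (InvImage.wf (fun U : Submodule 𝕜 E => n + 1 - finrank 𝕜 U) wellFounded_lt)
          {U ∈ A | U ≠ W} ⟨U₀, hU₀, hUW₀⟩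
        refine ⟨U, lt_of_le_of_ne (hAW U hU) hUW, fun U' hU' hne => ?_⟩
        by_contra hle
        have hlt : U < U' := ((hA.total hU hU').resolve_right hle).lt_of_ne
          (fun h => hle h.ge)
        have : FiniteDimensional 𝕜 U' := Submodule.finiteDimensional_of_le (hAW U' hU')
        have h1 := Submodule.finrank_lt_finrank_of_lt hlt
        have h2 := Submodule.finrank_mono (hAW U' hU')
        refine hmax U' ⟨hU', hne⟩ ?_
        change n + 1 - finrank 𝕜 U' < n + 1 - finrank 𝕜 U
        omega
      · push Not at hne
        refine ⟨⊥, bot_lt_iff_ne_bot.2 ?_, fun U hU h => absurd (hne U hU) h⟩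
        rintro rfl
        simp at hn
    obtain ⟨w, hwW, hwZ⟩ := SetLike.exists_of_lt hZW
    obtain ⟨φ, hφw, hφZ⟩ := Submodule.exists_le_ker_of_notMem hwZ
    -- A hyperplane `H` of `W` containing all members of `A` other than `W`.
    set H : Submodule 𝕜 E := W ⊓ LinearMap.ker φ with hH
    have hHW : H ≤ W := inf_le_left
    have hAH : ∀ U ∈ A, U ≠ W → U ≤ H := fun U hU h =>
      le_inf (hAW U hU) ((hAZ U hU h).trans hφZ)
    have hWφ : ¬ W ≤ LinearMap.ker φ := fun h => hφw (h hwW)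
    have hHn : finrank 𝕜 H = n := by
      have := finrank_inf_ker_add_one W φ hWφ
      rw [← hH] at this
      omega
    have : FiniteDimensional 𝕜 H := Submodule.finiteDimensional_of_le hHW
    -- A vector outside `H` which lies in every member of `B` not contained in `H`.
    obtain ⟨v, hvW, hvH, hvB⟩ : ∃ v ∈ W, v ∉ H ∧ ∀ U ∈ B, ¬ U ≤ H → v ∈ U := by
      by_cases hne : ∃ U ∈ B, ¬ U ≤ H
      · obtain ⟨U₀, hU₀, hUH₀⟩ := hne
        obtain ⟨U, ⟨hU, hUH⟩, hmin⟩ := WellFounded.has_min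
          (InvImage.wf (fun U : Submodule 𝕜 E => finrank 𝕜 U) wellFounded_lt)
          {U ∈ B | ¬ U ≤ H} ⟨U₀, hU₀, hUH₀⟩
        obtain ⟨v, hvU, hvH⟩ := SetLike.not_le_iff_exists.1 hUH
        refine ⟨v, hBW U hU hvU, hvH, fun U' hU' hne => ?_⟩
        by_contra hvU'
        have hlt : U' < U := ((hB.total hU hU').resolve_left fun hle => hvU' (hle hvU)).lt_of_ne
          (by rintro rfl; exact hvU' hvU)
        have : FiniteDimensional 𝕜 U := Submodule.finiteDimensional_of_le (hBW U hU)
        exact hmin U' ⟨hU', hne⟩ (Submodule.finrank_lt_finrank_of_lt hlt)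
      · push Not at hne
        exact ⟨w, hwW, fun h => hφw h.2, fun U hU h => absurd (hne U hU) h⟩
    have hφv : φ v ≠ 0 := fun h => hvH ⟨hvW, h⟩
    have hcover : ∀ U : Submodule 𝕜 E, U ≤ W → v ∈ U → (U ⊓ H) ⊔ Submodule.span 𝕜 {v} = U := by
      intro U hUW hvU
      refine le_antisymm (sup_le inf_le_left ((Submodule.span_singleton_le_iff_mem _ _).2 hvU)) ?_
      intro u hu
      refine Submodule.mem_sup.2 ⟨u - (φ u / φ v) • v, ⟨?_, ?_, ?_⟩, (φ u / φ v) • v,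
        Submodule.smul_mem _ _ (Submodule.mem_span_singleton_self v), sub_add_cancel _ _⟩
      · exact U.sub_mem hu (U.smul_mem _ hvU)
      · exact W.sub_mem (hUW hu) (W.smul_mem _ hvW)
      · simp [hφv]
    obtain ⟨s, hs, hspan, hsA, hsB⟩ := ih H {U ∈ A | U ≤ H} ((· ⊓ H) '' B)
      (hA.mono fun _ h => h.1) (hB.image_of_map_rel _ _ _ fun _ _ h => inf_le_inf_right H h)
      (fun U hU => hU.2) (by rintro _ ⟨U, -, rfl⟩; exact inf_le_right) hHn
    have hsH : s ⊆ H := hspan ▸ Submodule.subset_span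
    have hins : ∀ U : Submodule 𝕜 E, v ∈ U → insert v s ∩ (U : Set E) = insert v (s ∩ U) :=
      fun U h => Set.insert_inter_of_mem h
    have hWspan : Submodule.span 𝕜 (insert v s) = W := by
      rw [Submodule.span_insert, hspan, sup_comm]
      simpa [inf_eq_right.2 hHW] using hcover W le_rfl hvW
    have hnot : ∀ U : Submodule 𝕜 E, U ≤ H → insert v s ∩ (U : Set E) = s ∩ U :=
      fun U h => Set.insert_inter_of_notMem fun hv => hvH (h hv)
    refine ⟨insert v s, hs.id_insert (hspan ▸ hvH), hWspan, fun U hU => ?_, fun U hU => ?_⟩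
    · by_cases h : U = W
      · rw [h, Set.inter_eq_left.2 (hWspan ▸ Submodule.subset_span), hWspan]
      · rw [hnot U (hAH U hU h), hsA U ⟨hU, hAH U hU h⟩]
    · have hUH := hsB _ ⟨U, hU, rfl⟩
      have hset : s ∩ ((U ⊓ H : Submodule 𝕜 E) : Set E) = s ∩ U := by
        ext x
        simp only [Set.mem_inter_iff, Submodule.coe_inf]
        exact ⟨fun h => ⟨h.1, h.2.1⟩, fun h => ⟨h.1, h.2, hsH h.1⟩⟩
      simp only [hset] at hUH
      by_cases h : U ≤ H
      · rw [hnot U h, hUH, inf_eq_left.2 h]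
      · rw [hins U (hvB U hU h), Submodule.span_insert, hUH, sup_comm]
        exact hcover U (hBW U hU) (hvB U hU h)

/-- A reformulation of `exists_adapted_basis` with a basis of the ambient space: a vector lies in
a member of either chain exactly when all basis vectors occurring in it do. -/
theorem exists_basis_mem_iff {𝕜 : Type u} {E : Type v} [Field 𝕜] [AddCommGroup E] [Module 𝕜 E]
    (W : Submodule 𝕜 E) [FiniteDimensional 𝕜 W] (A B : Set (Submodule 𝕜 E))
    (hA : IsChain (· ≤ ·) A) (hB : IsChain (· ≤ ·) B)
    (hAW : ∀ U ∈ A, U ≤ W) (hBW : ∀ U ∈ B, U ≤ W) :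
    ∃ (ι : Type v) (β : Basis ι 𝕜 E),
      ∀ U, U ∈ A ∨ U ∈ B → ∀ x, x ∈ U ↔ ∀ i, β.repr x i ≠ 0 → β i ∈ U := by
  obtain ⟨s, hs, -, hsA, hsB⟩ := exists_adapted_basis W A B hA hB hAW hBW
  refine ⟨_, Basis.extend hs, fun U hU x => ⟨fun hx i hi => ?_, fun h => ?_⟩⟩
  · have hspan : Submodule.span 𝕜 (s ∩ U) = U := hU.elim (hsA U) (hsB U)
    have hsub : s ∩ (U : Set E) ⊆ (Basis.extend hs) '' {i | i.1 ∈ U} := fun y hy =>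
      ⟨⟨y, Basis.subset_extend hs hy.1⟩, hy.2, Basis.extend_apply_self hs _⟩
    have hx' : x ∈ Submodule.span 𝕜 ((Basis.extend hs) '' {i | i.1 ∈ U}) :=
      Submodule.span_mono hsub (hspan.symm ▸ hx)
    rw [Basis.extend_apply_self]
    exact (Basis.extend hs).mem_span_image.1 hx' (Finsupp.mem_support_iff.2 hi)
  · rw [← (Basis.extend hs).linearCombination_repr x, Finsupp.linearCombination_apply]
    exact U.sum_mem fun i hi => U.smul_mem _ (h i (Finsupp.mem_support_iff.1 hi))

theorem finite_setOf_basis_mem {𝕜 E ι : Type*} [Field 𝕜] [AddCommGroup E] [Module 𝕜 E]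
    (β : Basis ι 𝕜 E) (W : Submodule 𝕜 E) [FiniteDimensional 𝕜 W] : {i | β i ∈ W}.Finite := by
  have hli : LinearIndependent 𝕜 fun i : {i | β i ∈ W} => (⟨β i.1, i.2⟩ : W) :=
    LinearIndependent.of_comp W.subtype (β.linearIndependent.comp _ Subtype.val_injective)
  exact hli.finite

/-! ### Persistent intervals counted by ranks -/

open Filter Topology in
theorem eventually_le_coe_sub {x : EReal} {y : ℝ} (h : x < y) :
    ∀ᶠ ε : ℝ in 𝓝[>] 0, x ≤ ((y - ε : ℝ) : EReal) := by
  obtain ⟨r, hxr, hry⟩ := EReal.lt_iff_exists_real_btwn.1 h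
  have hry' : 0 < y - r := sub_pos.2 (EReal.coe_lt_coe_iff.1 hry)
  filter_upwards [Ioo_mem_nhdsGT hry'] with ε hε
  exact hxr.le.trans (EReal.coe_le_coe_iff.2 (by linarith [hε.2]))

/-- Points with negative birth are never `α`-persistent: for them `d / b < 1`, also when
`d = ∞`, where the quotient is `-∞`. For the other points the condition is `α * b ≤ d`. -/
theorem le_piValue_iff {α : ℝ} (hα : 1 < α) {b : ℝ} {d : EReal} (hbd : (b : EReal) < d) :
    (α : EReal) ≤ piValue (b, d) ↔ 0 ≤ b ∧ ((α * b : ℝ) : EReal) ≤ d := by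
  have h0 : (0 : ℝ) < α := by linarith
  unfold piValue
  rcases lt_trichotomy b 0 with hb | rfl | hb
  · simp only [hb.ne, if_false, hb.not_ge, false_and, iff_false, not_le]
    induction d with
    | bot => exact absurd hbd (not_lt_bot)
    | top =>
      rw [EReal.top_div_of_neg_ne_bot (by exact_mod_cast hb) (EReal.coe_ne_bot _)]
      exact EReal.bot_lt_coe _
    | coe d =>
      rw [← EReal.coe_div, EReal.coe_lt_coe_iff, div_lt_iff_of_neg hb]
      have := EReal.coe_lt_coe_iff.1 hbd
      nlinarith
  · simpa using hbd.le
  · simp only [hb.ne', if_false, hb.le, true_and]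
    rw [EReal.le_div_iff_mul_le (by exact_mod_cast hb) (EReal.coe_ne_top _), EReal.coe_mul]

open Classical in
/-- The number of intervals `[b i, d i)` of a family that contain the segment from `a` to `t`.
For a persistence module with this barcode it is the rank of the structure map from time `a`
to time `t`. -/
noncomputable def rankCount {ι : Type*} [Fintype ι] (b : ι → ℝ) (d : ι → EReal) (a t : ℝ) : ℕ :=
  (Finset.univ.filter fun i => b i ≤ a ∧ (t : EReal) < d i).card

open Classical in
/-- The number of intervals `[b i, d i)` of a family with `b i = β` and `α * β ≤ d i`. -/
noncomputable def bornCount {ι : Type*} [Fintype ι] (b : ι → ℝ) (d : ι → EReal) (α β : ℝ) : ℕ :=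
  (Finset.univ.filter fun i => b i = β ∧ ((α * β : ℝ) : EReal) ≤ d i).card

/-- The number of intervals born exactly at `β` and dying no earlier than `α * β` is a difference
of two ranks, once `ε` is at most every positive gap between the numbers involved. The target time
is `α * β - ε`, so that deaths at `α * β` itself are counted; for `β = 0` it has to be replaced by
`β`, where all intervals born at `0` are still alive. -/
theorem bornCount_add_rankCount {ι : Type*} [Fintype ι] {b : ι → ℝ} {d : ι → EReal}
    (hbd : ∀ i, (b i : EReal) < d i) {α β ε : ℝ} (hε : 0 < ε)
    (hβ : β = 0 ∨ β ≤ α * β - ε) (hb : ∀ i, b i < β → b i ≤ β - ε)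
    (hd : ∀ i, d i < ((α * β : ℝ) : EReal) → d i ≤ ((α * β - ε : ℝ) : EReal)) :
    bornCount b d α β + rankCount b d (β - ε) (max β (α * β - ε)) =
      rankCount b d β (max β (α * β - ε)) := by
  classical
  unfold bornCount rankCount
  rw [← Finset.card_union_of_disjoint]
  · congr 1
    ext i
    have key : b i = β → (((α * β : ℝ) : EReal) ≤ d i ↔
        ((max β (α * β - ε) : ℝ) : EReal) < d i) := by
      rintro rfl
      rcases hβ with h0 | hβ
      · have h1 : max (b i) (α * b i - ε) = b i := max_eq_left (by rw [h0]; linarith)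
        have h2 : α * b i = b i := by rw [h0, mul_zero]
        rw [h1, h2]
        exact ⟨fun _ => hbd i, fun h => h.le⟩
      · rw [max_eq_right hβ]
        refine ⟨fun h => lt_of_lt_of_le (EReal.coe_lt_coe_iff.2 (by linarith)) h, fun h => ?_⟩
        by_contra hlt
        exact absurd (hd i (not_le.1 hlt)) h.not_ge
    simp only [Finset.mem_union, Finset.mem_filter, Finset.mem_univ, true_and]
    constructor
    · rintro (⟨h1, h2⟩ | ⟨h1, h2⟩)
      · exact ⟨h1.le, (key h1).1 h2⟩
      · exact ⟨by linarith, h2⟩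
    · rintro ⟨h1, h2⟩
      rcases h1.eq_or_lt with h | h
      · exact Or.inl ⟨h, (key h).2 h2⟩
      · exact Or.inr ⟨hb i h, h2⟩
  · refine Finset.disjoint_filter.2 fun i _ h1 h2 => ?_
    linarith [h1.1, h2.1]

theorem persistentCount_eq_sum {ι : Type*} [Fintype ι] {b : ι → ℝ} {d : ι → EReal}
    (hbd : ∀ i, (b i : EReal) < d i) {α : ℝ} (hα : 1 < α) (S : Finset ℝ)
    (hS : ∀ β ∈ S, 0 ≤ β) (hbS : ∀ i, 0 ≤ b i → b i ∈ S) :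
    persistentCount α ((Finset.univ : Finset ι).val.map fun i => (b i, d i)) =
      ∑ β ∈ S, bornCount b d α β := by
  classical
  unfold persistentCount
  rw [Multiset.countP_map, ← Finset.filter_val, Finset.card_val,
    Finset.card_eq_sum_card_fiberwise (f := b) (t := S)]
  · refine Finset.sum_congr rfl fun β hβ => ?_
    unfold bornCount
    congr 1
    ext i
    simp only [Finset.mem_filter, Finset.mem_univ, true_and, le_piValue_iff hα (hbd i)]
    constructor
    · rintro ⟨⟨h1, h2⟩, rfl⟩
      exact ⟨rfl, h2⟩
    · rintro ⟨rfl, h2⟩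
      exact ⟨⟨hS _ hβ, h2⟩, rfl⟩
  · intro i hi
    simp only [Finset.coe_filter, Finset.mem_univ, true_and, Set.mem_ofPred_eq,
      le_piValue_iff hα (hbd i)] at hi
    exact hbS i hi.1

open Filter Topology in
open Classical in
/-- If the rank functions of two barcodes differ by the indicator of a relation `P`, then the
numbers of `α`-persistent intervals differ by at most one, provided that `P a t` is monotone in `a`
and satisfies the exchange condition `htrans`. By `bornCount_add_rankCount`, the counts differ by
the number of births `β ≥ 0` at which `P · t`, with `t` slightly below `α * β`, becomes true
exactly at `β`, and `htrans` excludes that this happens for two births. -/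
theorem persistentCount_of_rankCount {ι ι' : Type*} [Fintype ι] [Fintype ι']
    {b : ι → ℝ} {d : ι → EReal} {b' : ι' → ℝ} {d' : ι' → EReal}
    (hbd : ∀ i, (b i : EReal) < d i) (hbd' : ∀ i, (b' i : EReal) < d' i)
    (P : ℝ → ℝ → Prop)
    (hmono : ∀ a a' t, a ≤ a' → a' ≤ t → P a t → P a' t)
    (htrans : ∀ a a' a'' t t', a ≤ a' → a' ≤ a'' → a ≤ t → t ≤ t' → a'' ≤ t' →
      P a t → P a'' t' → P a' t')
    (hrank : ∀ a t, a ≤ t →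
      rankCount b d a t = rankCount b' d' a t + if P a t then 1 else 0)
    {α : ℝ} (hα : 1 < α) :
    persistentCount α ((Finset.univ : Finset ι').val.map fun i => (b' i, d' i)) ≤
      persistentCount α ((Finset.univ : Finset ι).val.map fun i => (b i, d i)) ∧
    persistentCount α ((Finset.univ : Finset ι).val.map fun i => (b i, d i)) ≤
      persistentCount α ((Finset.univ : Finset ι').val.map fun i => (b' i, d' i)) + 1 := by
  set S : Finset ℝ := (Finset.univ.image b ∪ Finset.univ.image b').filter (0 ≤ ·) with hSdef
  have hS : ∀ β ∈ S, 0 ≤ β := fun β hβ => (Finset.mem_filter.1 hβ).2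
  have hbS : ∀ i, 0 ≤ b i → b i ∈ S := fun i h => by simp [hSdef, h]
  have hbS' : ∀ i, 0 ≤ b' i → b' i ∈ S := fun i h => by simp [hSdef, h]
  -- Take `ε` at most every positive gap between the finitely many numbers involved.
  have hev : ∀ᶠ ε : ℝ in 𝓝[>] 0, 0 < ε ∧ ∀ β ∈ S, (β = 0 ∨ β ≤ α * β - ε) ∧
      (∀ γ ∈ S, γ < β → γ ≤ β - ε) ∧
      (∀ i, b i < β → b i ≤ β - ε) ∧
      (∀ i, d i < ((α * β : ℝ) : EReal) → d i ≤ ((α * β - ε : ℝ) : EReal)) ∧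
      (∀ i, b' i < β → b' i ≤ β - ε) ∧
      (∀ i, d' i < ((α * β : ℝ) : EReal) → d' i ≤ ((α * β - ε : ℝ) : EReal)) := by
    have real : ∀ x y : ℝ, ∀ᶠ ε : ℝ in 𝓝[>] 0, x < y → x ≤ y - ε := fun x y => by
      by_cases h : x < y
      · filter_upwards [eventually_le_coe_sub (EReal.coe_lt_coe_iff.2 h)] with ε hε _
        exact EReal.coe_le_coe_iff.1 hε
      · exact Eventually.of_forall fun _ h' => absurd h' h
    have ereal : ∀ (x : EReal) (y : ℝ), ∀ᶠ ε : ℝ in 𝓝[>] 0,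
        x < y → x ≤ ((y - ε : ℝ) : EReal) := fun x y => by
      by_cases h : x < y
      · filter_upwards [eventually_le_coe_sub h] with ε hε _ using hε
      · exact Eventually.of_forall fun _ h' => absurd h' h
    refine (eventually_mem_nhdsWithin).and ((Finset.eventually_all S).2 fun β hβ => ?_)
    refine Eventually.and ?_ <| ((Finset.eventually_all S).2 fun γ _ => real γ β).and <|
      (eventually_all.2 fun i => real (b i) β).and <|
      (eventually_all.2 fun i => ereal (d i) (α * β)).and <|
      (eventually_all.2 fun i => real (b' i) β).and <|
      eventually_all.2 fun i => ereal (d' i) (α * β)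
    filter_upwards [real β (α * β)] with ε hε
    rcases (hS β hβ).eq_or_lt with h | h
    · exact Or.inl h.symm
    · exact Or.inr (hε (by nlinarith))
  obtain ⟨ε, hε, hgap⟩ := hev.exists
  have hborn : ∀ β ∈ S, bornCount b d α β = bornCount b' d' α β +
      if P β (max β (α * β - ε)) ∧ ¬ P (β - ε) (max β (α * β - ε)) then 1 else 0 := by
    intro β hβ
    obtain ⟨h1, -, h2, h3, h4, h5⟩ := hgap β hβ
    have e1 := bornCount_add_rankCount hbd hε h1 h2 h3
    have e2 := bornCount_add_rankCount hbd' hε h1 h4 h5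
    rw [hrank _ _ (le_max_left _ _),
      hrank _ _ ((sub_le_self β hε.le).trans (le_max_left _ _))] at e1
    have h6 := hmono (β - ε) β (max β (α * β - ε)) (sub_le_self β hε.le) (le_max_left _ _)
    by_cases hP : P β (max β (α * β - ε)) <;> by_cases hP' : P (β - ε) (max β (α * β - ε)) <;>
      simp only [hP, hP', if_true, if_false, not_true, not_false_eq_true, and_true, and_false,
        and_self] at e1 ⊢ <;> first | omega | exact absurd (h6 hP') hP
  rw [persistentCount_eq_sum hbd hα S hS hbS, persistentCount_eq_sum hbd' hα S hS hbS',
    Finset.sum_congr rfl hborn, Finset.sum_add_distrib, ← Finset.card_filter]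
  refine ⟨Nat.le_add_right _ _, Nat.add_le_add_left (Finset.card_le_one.2 ?_) _⟩
  have hne : ∀ β ∈ S, ∀ γ ∈ S, β < γ → P β (max β (α * β - ε)) → P γ (max γ (α * γ - ε)) →
      P (γ - ε) (max γ (α * γ - ε)) := by
    intro β hβ γ hγ hlt h1 h2
    refine htrans β (γ - ε) γ _ _ ((hgap γ hγ).2.1 β hβ hlt) (sub_le_self γ hε.le)
      (le_max_left _ _) (max_le_max hlt.le ?_) (le_max_left _ _) h1 h2
    nlinarith
  intro β hβ γ hγ
  rw [Finset.mem_filter] at hβ hγ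
  rcases lt_trichotomy β γ with h | h | h
  · exact absurd (hne β hβ.1 γ hγ.1 h hβ.2.1 hγ.2.1) hγ.2.2
  · exact h
  · exact absurd (hne γ hγ.1 β hβ.1 h hγ.2.1 hβ.2.1) hβ.2.2

/-! ### Ranks of interval decomposable modules -/

theorem PersistenceModule.Iso.finrank_range_map_eq {𝕜 : Type u} [Field 𝕜]
    {M : PersistenceModule.{u, v} 𝕜} {N : PersistenceModule.{u, w} 𝕜} (e : M.Iso N) {a t : ℝ}
    (h : a ≤ t) :
    finrank 𝕜 (LinearMap.range (M.map h)) = finrank 𝕜 (LinearMap.range (N.map h)) := by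
  rw [← LinearEquiv.finrank_map_eq (e.equiv t) (LinearMap.range (M.map h))]
  have : (LinearMap.range (M.map h)).map (e.equiv t : M.obj t →ₗ[𝕜] N.obj t) =
      LinearMap.range (N.map h) := by
    ext y
    constructor
    · rintro ⟨_, ⟨x, rfl⟩, rfl⟩
      exact ⟨e.equiv a x, (e.naturality h x).symm⟩
    · rintro ⟨x, rfl⟩
      refine ⟨_, ⟨(e.equiv a).symm x, rfl⟩, ?_⟩
      simpa using e.naturality h ((e.equiv a).symm x)
  rw [this]

theorem coe_intervalModule_map {𝕜 : Type u} [Field 𝕜] (b : ℝ) (d : EReal) {a t : ℝ} (h : a ≤ t)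
    (ht : (t : EReal) < d) (x : (intervalModule 𝕜 b d).obj a) :
    (intervalSpace 𝕜 b d t).subtype ((intervalModule 𝕜 b d).map h x) =
      (intervalSpace 𝕜 b d a).subtype x := by
  simp only [intervalModule, ht, dite_true]
  rfl

theorem coe_eq_zero_of_mem_intervalSpace {𝕜 : Type u} [Field 𝕜] {b : ℝ} {d : EReal} {t : ℝ}
    (h : ¬ (b ≤ t ∧ (t : EReal) < d)) (x : intervalSpace 𝕜 b d t) :
    (intervalSpace 𝕜 b d t).subtype x = 0 :=
  x.2.resolve_left h

/-- The rank of a structure map of a sum of interval modules counts the intervals that contain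
both its source and its target time. -/
theorem finrank_range_directSum_intervalModule {𝕜 : Type u} [Field 𝕜] {ι : Type v} [Fintype ι]
    (b : ι → ℝ) (d : ι → EReal) {a t : ℝ} (h : a ≤ t) :
    finrank 𝕜 (LinearMap.range
      ((PersistenceModule.directSum fun i => intervalModule 𝕜 (b i) (d i)).map h)) =
      rankCount b d a t := by
  classical
  set N := PersistenceModule.directSum fun i => intervalModule 𝕜 (b i) (d i)
  -- `L` reads off the coordinates of the intervals that contain both times.
  let J := {i : ι // b i ≤ a ∧ (t : EReal) < d i}
  let L : N.obj t →ₗ[𝕜] (J → 𝕜) := LinearMap.pi fun j =>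
    (intervalSpace 𝕜 (b j.1) (d j.1) t).subtype ∘ₗ
      DirectSum.component 𝕜 ι (fun i => (intervalModule 𝕜 (b i) (d i)).obj t) j.1
  have hinj : Function.Injective (L.domRestrict (LinearMap.range (N.map h))) := by
    rw [injective_iff_map_eq_zero]
    rintro ⟨_, x, rfl⟩ hx
    let y : ⨁ i, (intervalModule 𝕜 (b i) (d i)).obj a := x
    refine Subtype.ext (DirectSum.ext_component 𝕜 fun i => ?_)
    change (intervalModule 𝕜 (b i) (d i)).map h (y i) = 0
    refine (intervalSpace 𝕜 (b i) (d i) t).injective_subtype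
      (Eq.trans ?_ (map_zero (intervalSpace 𝕜 (b i) (d i) t).subtype).symm)
    by_cases ht : (t : EReal) < d i
    · by_cases hb : b i ≤ a
      · exact congr_fun hx ⟨i, hb, ht⟩
      · exact (coe_intervalModule_map _ _ h ht _).trans
          (coe_eq_zero_of_mem_intervalSpace (fun h' => hb h'.1) _)
    · exact coe_eq_zero_of_mem_intervalSpace (fun h' => ht h'.2) _
  have hsurj : Function.Surjective (L.domRestrict (LinearMap.range (N.map h))) := by
    intro c
    let x : ⨁ i, (intervalModule 𝕜 (b i) (d i)).obj a := DFinsupp.equivFunOnFintype.symm fun i =>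
      if hi : b i ≤ a ∧ (t : EReal) < d i then
        (⟨c ⟨i, hi⟩, Or.inl ⟨hi.1, (EReal.coe_le_coe_iff.2 h).trans_lt hi.2⟩⟩ :
          intervalSpace 𝕜 (b i) (d i) a)
      else (0 : intervalSpace 𝕜 (b i) (d i) a)
    refine ⟨⟨N.map h x, x, rfl⟩, funext fun j => ?_⟩
    change (intervalSpace 𝕜 (b j.1) (d j.1) t).subtype
      ((intervalModule 𝕜 (b j.1) (d j.1)).map h (x j.1)) = c j
    refine (coe_intervalModule_map _ _ h j.2.2 _).trans ?_
    have : x j.1 = (⟨c j, Or.inl ⟨j.2.1, (EReal.coe_le_coe_iff.2 h).trans_lt j.2.2⟩⟩ :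
        intervalSpace 𝕜 (b j.1) (d j.1) a) := dif_pos j.2
    rw [this]
    rfl
  rw [(LinearEquiv.ofBijective _ ⟨hinj, hsurj⟩).finrank_eq, finrank_fintype_fun_eq_card,
    Fintype.card_subtype]
  unfold rankCount
  congr

/-! ### Interval decomposition of persistent homology -/

section Homology

variable {𝕜 : Type u} [Field 𝕜] {V : Type v}

theorem Filtration.sublevel_le (F : Filtration V) (t : ℝ) : F.sublevel t ≤ F.complex :=
  fun _ h => h.1

theorem Filtration.finite_sublevel (F : Filtration V) (t : ℝ) :
    (F.sublevel t).faces.Finite :=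
  F.finite.subset fun _ h => h.1

theorem Filtration.exists_complex_le_sublevel (F : Filtration V) :
    ∃ t, F.complex ≤ F.sublevel t := by
  obtain ⟨t, ht⟩ := (F.finite.image F.time).bddAbove
  exact ⟨t, fun s hs => ⟨hs, ht ⟨s, hs, rfl⟩⟩⟩

/-- A monotone property of complexes that fails for the empty complex and is eventually true
along a filtration becomes true at a definite time, since the complex only changes
at finitely many times, and never just after some time. -/
theorem Filtration.exists_sublevel_iff (F : Filtration V)
    (p : PreAbstractSimplicialComplex V → Prop) (hmono : ∀ K L, K ≤ L → p K → p L)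
    (hempty : ∀ K, p K → K.faces.Nonempty) (hne : ∃ t, p (F.sublevel t)) :
    ∃ m : ℝ, ∀ t, p (F.sublevel t) ↔ m ≤ t := by
  have key : ∀ t, p (F.sublevel t) →
      ∃ τ ∈ F.time '' F.complex.faces, τ ≤ t ∧ p (F.sublevel τ) := by
    intro t ht
    obtain ⟨s, hs, hmax⟩ := (F.finite_sublevel t).exists_maximalFor F.time _ (hempty _ ht)
    refine ⟨F.time s, ⟨s, hs.1, rfl⟩, hs.2,
      hmono _ _ (fun r (hr : r ∈ (F.sublevel t).faces) => ⟨hr.1, ?_⟩) ht⟩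
    rcases le_total (F.time r) (F.time s) with h | h
    · exact h
    · exact hmax hr h
  have hfin : {τ ∈ F.time '' F.complex.faces | p (F.sublevel τ)}.Finite :=
    (F.finite.image F.time).subset fun _ h => h.1
  obtain ⟨t₀, ht₀⟩ := hne
  obtain ⟨τ₀, hτ₀, -, hp₀⟩ := key t₀ ht₀
  obtain ⟨m, hm, hmin⟩ := hfin.exists_minimal ⟨τ₀, hτ₀, hp₀⟩
  refine ⟨m, fun t => ⟨fun ht => ?_, fun ht => hmono _ _ (F.sublevel_mono ht) hm.2⟩⟩
  obtain ⟨τ, hτ, hle, hp⟩ := key t ht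
  rcases le_total m τ with h | h
  · exact h.trans hle
  · exact (hmin ⟨hτ, hp⟩ h).trans hle

theorem finiteDimensional_chains (K : PreAbstractSimplicialComplex V) (hK : K.faces.Finite)
    (k : ℕ) : FiniteDimensional 𝕜 (chains 𝕜 K k) := by
  have : Finite {s | s ∈ K ∧ s.card = k + 1} := hK.subset fun s hs => hs.1
  exact Module.Finite.equiv
    (Finsupp.supportedEquivFinsupp (M := 𝕜) (R := 𝕜) {s | s ∈ K ∧ s.card = k + 1}).symm

theorem faces_nonempty_of_mem_chains {K : PreAbstractSimplicialComplex V} {k : ℕ}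
    {x : Finset V →₀ 𝕜} (hx : x ∈ chains 𝕜 K k) (h0 : x ≠ 0) : K.faces.Nonempty := by
  obtain ⟨s, hs⟩ := Finsupp.support_nonempty_iff.2 h0
  exact ⟨s, ((Finsupp.mem_supported 𝕜 x).1 hx hs).1⟩

variable [LinearOrder V]

theorem finiteDimensional_cycles (K : PreAbstractSimplicialComplex V) (hK : K.faces.Finite)
    (k : ℕ) : FiniteDimensional 𝕜 (cycles 𝕜 K k) :=
  have := finiteDimensional_chains (𝕜 := 𝕜) K hK k
  Submodule.finiteDimensional_of_le (inf_le_left : cycles 𝕜 K k ≤ chains 𝕜 K k)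

/-- The rank of `H_k(K) → H_k(L)` is `dim Z_k(K) - dim (Z_k(K) ∩ B_k(L))`. -/
theorem finrank_range_homologyMap_add {K L : PreAbstractSimplicialComplex V} (h : K ≤ L)
    (hK : K.faces.Finite) (k : ℕ) :
    finrank 𝕜 (LinearMap.range (homologyMap (𝕜 := 𝕜) h k)) +
      finrank 𝕜 ↥(cycles 𝕜 K k ⊓ boundaries 𝕜 L k) = finrank 𝕜 (cycles 𝕜 K k) := by
  have := finiteDimensional_cycles (𝕜 := 𝕜) K hK k
  have h1 := (homologyMap (𝕜 := 𝕜) h k ∘ₗ Submodule.mkQ _).finrank_range_add_finrank_ker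
  rw [LinearMap.range_comp_of_range_eq_top _ (Submodule.range_mkQ _)] at h1
  have hker : LinearMap.ker (homologyMap (𝕜 := 𝕜) h k ∘ₗ Submodule.mkQ _) =
      (boundaries 𝕜 L k).comap (cycles 𝕜 K k).subtype := by
    have : homologyMap (𝕜 := 𝕜) h k ∘ₗ Submodule.mkQ _ =
      Submodule.mkQ _ ∘ₗ Submodule.inclusion (cycles_mono h k) := rfl
    rw [this, LinearMap.ker_comp, Submodule.ker_mkQ]
    rfl
  rwa [hker, finrank_comap_subtype] at h1

/-- Persistent homology decomposes into interval modules. With a basis adapted to both the cycles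
`Z t` and the boundaries `B t`, the homology at time `t` has a basis given by the basis vectors in
`Z t` but not in `B t`; each of them spans an interval summand, from the time it becomes a cycle
to the time it becomes a boundary. -/
theorem exists_isDiagram (𝕜 : Type u) [Field 𝕜] (F : Filtration V) (k : ℕ) :
    ∃ D, IsDiagram (persistentHomology 𝕜 F k) D := by
  classical
  set Z : ℝ → Submodule 𝕜 (Finset V →₀ 𝕜) := fun t => cycles 𝕜 (F.sublevel t) k
  set B : ℝ → Submodule 𝕜 (Finset V →₀ 𝕜) := fun t => boundaries 𝕜 (F.sublevel t) k
  have hZmono : Monotone Z := fun _ _ h => cycles_mono (F.sublevel_mono h) k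
  have hBmono : Monotone B := fun _ _ h => boundaries_mono (F.sublevel_mono h) k
  have hBZ : ∀ t, B t ≤ Z t := fun t => boundaries_le_cycles _ k
  set W := cycles 𝕜 F.complex k
  have : FiniteDimensional 𝕜 W := finiteDimensional_cycles _ F.finite k
  have hZW : ∀ t, Z t ≤ W := fun t => cycles_mono (F.sublevel_le t) k
  obtain ⟨ι, β, hβ⟩ := exists_basis_mem_iff W (Set.range Z) (Set.range B)
    hZmono.isChain_range hBmono.isChain_range
    (by rintro _ ⟨t, rfl⟩; exact hZW t) (by rintro _ ⟨t, rfl⟩; exact (hBZ t).trans (hZW t))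
  have hβZ : ∀ t x, x ∈ Z t ↔ ∀ i, β.repr x i ≠ 0 → β i ∈ Z t := fun t => hβ _ (Or.inl ⟨t, rfl⟩)
  have hβB : ∀ t x, x ∈ B t ↔ ∀ i, β.repr x i ≠ 0 → β i ∈ B t := fun t => hβ _ (Or.inr ⟨t, rfl⟩)
  have hbirth : ∀ i, ∃ b : ℝ, β i ∈ W → ∀ t, β i ∈ Z t ↔ b ≤ t := by
    intro i
    by_cases hi : β i ∈ W
    · obtain ⟨t, ht⟩ := F.exists_complex_le_sublevel
      obtain ⟨b, hb⟩ := F.exists_sublevel_iff (fun K => β i ∈ cycles 𝕜 K k)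
        (fun K L h hK => cycles_mono h k hK)
        (fun K hK => faces_nonempty_of_mem_chains hK.1 (β.ne_zero i))
        ⟨t, cycles_mono ht k hi⟩
      exact ⟨b, fun _ => hb⟩
    · exact ⟨0, fun h => absurd h hi⟩
  have hdeath : ∀ i, ∃ d : EReal, ∀ t : ℝ, β i ∈ B t ↔ d ≤ t := by
    intro i
    by_cases hi : ∃ t, β i ∈ B t
    · obtain ⟨d, hd⟩ := F.exists_sublevel_iff (fun K => β i ∈ boundaries 𝕜 K k)
        (fun K L h hK => boundaries_mono h k hK)
        (fun K hK => faces_nonempty_of_mem_chains (boundaries_le_cycles K k hK).1 (β.ne_zero i)) hi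
      exact ⟨d, fun t => (hd t).trans EReal.coe_le_coe_iff.symm⟩
    · push Not at hi
      exact ⟨⊤, fun t => ⟨fun h => absurd h (hi t), fun h => absurd h (EReal.coe_lt_top t).not_ge⟩⟩
  choose b hb using hbirth
  choose d hd using hdeath
  -- The basis vectors that live for a nonempty interval.
  have hfin : {i | β i ∈ W ∧ (b i : EReal) < d i}.Finite :=
    (finite_setOf_basis_mem β W).subset fun i hi => hi.1
  obtain ⟨n, ⟨e⟩⟩ := (@Finite.exists_equiv_fin _ hfin)
  let f : Fin n → ι := fun j => (e.symm j).1
  have hfW : ∀ j, β (f j) ∈ W := fun j => (e.symm j).2.1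
  have hfbd : ∀ j, (b (f j) : EReal) < d (f j) := fun j => (e.symm j).2.2
  have hfinj : Function.Injective f := Subtype.val_injective.comp e.symm.injective
  have hfsurj : ∀ i t, β i ∈ Z t → β i ∉ B t → ∃ j, f j = i := by
    intro i t h1 h2
    have hW := hZW t h1
    refine ⟨e ⟨i, hW, ?_⟩, by simp [f]⟩
    exact (EReal.coe_le_coe_iff.2 ((hb i hW t).1 h1)).trans_lt (not_le.1 fun h => h2 ((hd i t).2 h))
  let M : Fin n → PersistenceModule.{u, u} 𝕜 := fun j => intervalModule 𝕜 (b (f j)) (d (f j))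
  -- The coordinates of a cycle, those of dead basis vectors being discarded.
  let c : ∀ (t : ℝ) (j : Fin n), Z t →ₗ[𝕜] intervalSpace 𝕜 (b (f j)) (d (f j)) t := fun t j =>
    if h : b (f j) ≤ t ∧ (t : EReal) < d (f j) then
      (β.coord (f j) ∘ₗ (Z t).subtype).codRestrict _ fun _ => Or.inl h
    else 0
  have hc : ∀ t j (x : Z t), (t : EReal) < d (f j) →
      (intervalSpace 𝕜 (b (f j)) (d (f j)) t).subtype (c t j x) = β.repr x (f j) := by
    intro t j x ht
    by_cases h : b (f j) ≤ t
    · simp only [c, dif_pos (And.intro h ht)]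
      rfl
    · simp only [c, h, false_and, dif_neg, not_false_eq_true, LinearMap.zero_apply, map_zero]
      by_contra h0
      exact h ((hb _ (hfW j) t).1 ((hβZ t x).1 x.2 (f j) (Ne.symm h0)))
  let φ : ∀ t, Z t →ₗ[𝕜] ⨁ j, (M j).obj t := fun t =>
    (DirectSum.linearEquivFunOnFintype 𝕜 (Fin n) (fun j => (M j).obj t)).symm.toLinearMap ∘ₗ
      LinearMap.pi (c t)
  have hφ : ∀ t x j, φ t x j = c t j x := fun t x j => rfl
  have hker : ∀ t, LinearMap.ker (φ t) = (B t).submoduleOf (Z t) := by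
    intro t
    ext x
    rw [LinearMap.mem_ker]
    change _ ↔ (x : Finset V →₀ 𝕜) ∈ B t
    rw [hβB]
    constructor
    · intro h i hi
      by_contra hiB
      obtain ⟨j, rfl⟩ := hfsurj i t ((hβZ t x).1 x.2 i hi) hiB
      refine hi ?_
      rw [← hc t j x (not_le.1 fun h => hiB ((hd _ t).2 h)), ← hφ, h]
      exact map_zero _
    · intro h
      refine DirectSum.ext_component 𝕜 fun j => ?_
      refine (intervalSpace 𝕜 (b (f j)) (d (f j)) t).injective_subtype
        (Eq.trans ?_ (map_zero (intervalSpace 𝕜 (b (f j)) (d (f j)) t).subtype).symm)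
      change (intervalSpace 𝕜 (b (f j)) (d (f j)) t).subtype (c t j x) = 0
      by_cases ht : (t : EReal) < d (f j)
      · rw [hc t j x ht]
        by_contra h0
        exact absurd ((hd _ t).1 (h _ h0)) ht.not_ge
      · exact coe_eq_zero_of_mem_intervalSpace (fun h' => ht h'.2) _
  have hsurj : ∀ t, Function.Surjective (φ t) := by
    intro t y
    let y' : ∀ j, intervalSpace 𝕜 (b (f j)) (d (f j)) t := fun j => y j
    have hmem : ∑ j, (y' j : 𝕜) • β (f j) ∈ Z t := by
      refine Submodule.sum_mem _ fun j _ => ?_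
      rcases (y' j).2 with h | h
      · exact Submodule.smul_mem _ _ ((hb _ (hfW j) t).2 h.1)
      · rw [h, zero_smul]
        exact Submodule.zero_mem _
    refine ⟨⟨_, hmem⟩, DirectSum.ext_component 𝕜 fun j => ?_⟩
    refine (intervalSpace 𝕜 (b (f j)) (d (f j)) t).injective_subtype ?_
    change (intervalSpace 𝕜 (b (f j)) (d (f j)) t).subtype (c t j ⟨_, hmem⟩) = (y' j : 𝕜)
    by_cases ht : (t : EReal) < d (f j)
    · rw [hc t j _ ht]
      simp only [map_sum, map_smul, Basis.repr_self, Finsupp.finsetSum_apply, Finsupp.smul_apply,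
        Finsupp.single_apply, hfinj.eq_iff, smul_eq_mul, mul_ite, mul_one, mul_zero,
        Finset.sum_ite_eq', Finset.mem_univ, if_true]
    · exact (coe_eq_zero_of_mem_intervalSpace (fun h' => ht h'.2) _).trans
        (coe_eq_zero_of_mem_intervalSpace (fun h' => ht h'.2) (y' j)).symm
  refine ⟨_, n, fun j => b (f j), fun j => d (f j), hfbd, ⟨⟨fun t =>
    (Submodule.quotEquivOfEq _ _ (hker t).symm).trans
      ((φ t).quotKerEquivOfSurjective (hsurj t)), ?_⟩⟩, rfl⟩
  intro s t hst x
  obtain ⟨x, rfl⟩ := Submodule.Quotient.mk_surjective _ x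
  change φ t (Submodule.inclusion (hZmono hst) x) =
    (PersistenceModule.directSum M).map hst (φ s x)
  refine DirectSum.ext_component 𝕜 fun j => ?_
  refine (intervalSpace 𝕜 (b (f j)) (d (f j)) t).injective_subtype ?_
  change (intervalSpace 𝕜 (b (f j)) (d (f j)) t).subtype (c t j _) =
    (intervalSpace 𝕜 (b (f j)) (d (f j)) t).subtype ((M j).map hst (c s j x))
  by_cases ht : (t : EReal) < d (f j)
  · exact (hc t j _ ht).trans ((hc s j x ((EReal.coe_le_coe_iff.2 hst).trans_lt ht)).symm.trans
      (coe_intervalModule_map _ _ hst ht _).symm)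
  · exact (coe_eq_zero_of_mem_intervalSpace (fun h' => ht h'.2) _).trans
      (coe_eq_zero_of_mem_intervalSpace (fun h' => ht h'.2) _).symm

end Homology

/-! ### Adding one simplex -/

theorem mem_sup_span_singleton_exchange {𝕜 E : Type*} [Field 𝕜] [AddCommGroup E] [Module 𝕜 E]
    {B : Submodule 𝕜 E} {y z : E} (hz : z ∈ B ⊔ Submodule.span 𝕜 {y}) (hzB : z ∉ B) :
    y ∈ B ⊔ Submodule.span 𝕜 {z} := by
  obtain ⟨x, hx, _, hc, rfl⟩ := Submodule.mem_sup.1 hz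
  obtain ⟨c, rfl⟩ := Submodule.mem_span_singleton.1 hc
  have hc0 : c ≠ 0 := by
    rintro rfl
    exact hzB (by simpa using hx)
  refine Submodule.mem_sup.2 ⟨-(c⁻¹ • x), B.neg_mem (B.smul_mem _ hx), c⁻¹ • (x + c • y),
    Submodule.smul_mem _ _ (Submodule.mem_span_singleton_self _), ?_⟩
  rw [smul_add, neg_add_cancel_left, inv_smul_smul₀ hc0]

open Classical in
/-- Enlarging `B` by at most one dimension enlarges its intersection with `Z` by at most one
dimension. -/
theorem finrank_inf_eq_add {𝕜 E : Type*} [Field 𝕜] [AddCommGroup E] [Module 𝕜 E]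
    {Z B B' : Submodule 𝕜 E} [FiniteDimensional 𝕜 Z] {y : E} (hBB' : B ≤ B')
    (hB' : B' ≤ B ⊔ Submodule.span 𝕜 {y}) :
    finrank 𝕜 ↥(Z ⊓ B') = finrank 𝕜 ↥(Z ⊓ B) + if ¬ Z ⊓ B' ≤ B then 1 else 0 := by
  by_cases h : Z ⊓ B' ≤ B
  · rw [if_neg (not_not.2 h), add_zero,
      le_antisymm (le_inf inf_le_left h) (inf_le_inf_left Z hBB')]
  · obtain ⟨z, hz, hzB⟩ := SetLike.not_le_iff_exists.1 h
    obtain ⟨φ, hφz, hφB⟩ := Submodule.exists_le_ker_of_notMem hzB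
    have : FiniteDimensional 𝕜 ↥(Z ⊓ B') := Submodule.finiteDimensional_of_le inf_le_left
    have hker : Z ⊓ B' ⊓ LinearMap.ker φ = Z ⊓ B := by
      refine le_antisymm (fun x hx => ⟨hx.1.1, ?_⟩)
        (le_inf (inf_le_inf_left Z hBB') (inf_le_right.trans hφB))
      have hy := mem_sup_span_singleton_exchange (hB' hz.2) hzB
      have hx' : x ∈ B ⊔ Submodule.span 𝕜 {z} :=
        (hB'.trans (sup_le le_sup_left ((Submodule.span_singleton_le_iff_mem _ _).2 hy))) hx.1.2
      obtain ⟨x₀, hx₀, _, hc, rfl⟩ := Submodule.mem_sup.1 hx'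
      obtain ⟨c, rfl⟩ := Submodule.mem_span_singleton.1 hc
      have h0 : φ (x₀ + c • z) = 0 := hx.2
      rw [map_add, show φ x₀ = 0 from hφB hx₀, zero_add, map_smul, smul_eq_mul] at h0
      rw [(mul_eq_zero.1 h0).resolve_right hφz, zero_smul, add_zero]
      exact hx₀
    rw [if_pos h, ← hker]
    exact (finrank_inf_ker_add_one _ φ fun h' => hφz (h' hz)).symm

section Addition

variable {V : Type v} {F F' : Filtration V} {σ : Finset V}

theorem Filtration.IsAddition.mem_sublevel_iff (h : F.IsAddition σ F') {s : Finset V} (hs : s ≠ σ)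
    (t : ℝ) : s ∈ F'.sublevel t ↔ s ∈ F.sublevel t := by
  have hc : s ∈ F'.complex ↔ s ∈ F.complex := by
    change s ∈ F'.complex.faces ↔ _
    rw [h.faces_eq, Set.mem_insert_iff]
    exact or_iff_right hs
  change s ∈ F'.complex ∧ F'.time s ≤ t ↔ s ∈ F.complex ∧ F.time s ≤ t
  rw [hc]
  exact and_congr_right fun hF => by rw [h.time_eq s hF]

theorem Filtration.IsAddition.sublevel_le (h : F.IsAddition σ F') (t : ℝ) :
    F.sublevel t ≤ F'.sublevel t := fun s hs =>
  (h.mem_sublevel_iff (by rintro rfl; exact h.notMem hs.1) t).2 hs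

theorem Filtration.IsAddition.mem_sublevel_self_iff (h : F.IsAddition σ F') (t : ℝ) :
    σ ∈ F'.sublevel t ↔ F'.time σ ≤ t := by
  have : σ ∈ F'.complex := by
    change σ ∈ F'.complex.faces
    rw [h.faces_eq]
    exact Set.mem_insert _ _
  exact and_iff_right this

variable (𝕜 : Type u) [Field 𝕜]

theorem Filtration.IsAddition.chains_eq (h : F.IsAddition σ F') {k : ℕ} (hk : σ.card ≠ k + 1)
    (t : ℝ) : chains 𝕜 (F'.sublevel t) k = chains 𝕜 (F.sublevel t) k := by
  unfold chains
  congr 1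
  ext s
  refine and_congr_left fun hs => h.mem_sublevel_iff ?_ t
  rintro rfl
  exact hk hs

open Classical in
theorem Filtration.IsAddition.chains_eq_sup (h : F.IsAddition σ F') {k : ℕ} (hk : σ.card = k + 1)
    (t : ℝ) : chains 𝕜 (F'.sublevel t) k = chains 𝕜 (F.sublevel t) k ⊔
      if F'.time σ ≤ t then Submodule.span 𝕜 {Finsupp.single σ 1} else ⊥ := by
  split_ifs with ht
  · rw [← Set.image_singleton (f := fun s => Finsupp.single s (1 : 𝕜)),
      ← Finsupp.supported_eq_span_single, chains, chains, ← Finsupp.supported_union]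
    congr 1
    ext s
    simp only [Set.mem_union, Set.mem_ofPred_eq, Set.mem_singleton_iff]
    by_cases hs : s = σ
    · subst hs
      simp [hk, (h.mem_sublevel_self_iff t).2 ht]
    · simp [hs, h.mem_sublevel_iff hs t]
  · rw [sup_bot_eq, chains, chains]
    congr 1
    ext s
    refine and_congr_left fun _ => ?_
    by_cases hs : s = σ
    · subst hs
      exact iff_of_false (fun h' => ht ((h.mem_sublevel_self_iff t).1 h')) fun h' => h.notMem h'.1
    · exact h.mem_sublevel_iff hs t

variable [LinearOrder V]

theorem Filtration.IsAddition.cycles_eq (h : F.IsAddition σ F') {k : ℕ} (hk : σ.card ≠ k + 1)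
    (t : ℝ) : cycles 𝕜 (F'.sublevel t) k = cycles 𝕜 (F.sublevel t) k := by
  rw [cycles, h.chains_eq 𝕜 hk, cycles]

theorem Filtration.IsAddition.boundaries_eq (h : F.IsAddition σ F') {k : ℕ}
    (hk : σ.card ≠ k + 2) (t : ℝ) :
    boundaries 𝕜 (F'.sublevel t) k = boundaries 𝕜 (F.sublevel t) k := by
  rw [boundaries, h.chains_eq 𝕜 hk, boundaries]

open Classical in
theorem Filtration.IsAddition.boundaries_eq_sup (h : F.IsAddition σ F') {k : ℕ}
    (hk : σ.card = k + 2) (t : ℝ) :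
    boundaries 𝕜 (F'.sublevel t) k = boundaries 𝕜 (F.sublevel t) k ⊔
      if F'.time σ ≤ t then Submodule.span 𝕜 {boundary 𝕜 (Finsupp.single σ 1)} else ⊥ := by
  rw [boundaries, h.chains_eq_sup 𝕜 hk, Submodule.map_sup, boundaries]
  split_ifs
  · rw [Submodule.map_span, Set.image_singleton]
  · rw [Submodule.map_bot]

/-- A cycle of the enlarged complex that does not use the new simplex is a cycle of the
old one. -/
theorem Filtration.IsAddition.mem_cycles_iff (h : F.IsAddition σ F') (k : ℕ) (t : ℝ)
    (x : Finset V →₀ 𝕜) :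
    x ∈ cycles 𝕜 (F.sublevel t) k ↔ x ∈ cycles 𝕜 (F'.sublevel t) k ∧ x σ = 0 := by
  constructor
  · refine fun hx => ⟨cycles_mono (h.sublevel_le t) k hx, ?_⟩
    by_contra h0
    exact h.notMem ((Finsupp.mem_supported 𝕜 x).1 hx.1 (Finsupp.mem_support_iff.2 h0)).1.1
  · rintro ⟨hx, h0⟩
    refine ⟨(Finsupp.mem_supported 𝕜 x).2 fun s hs => ?_, hx.2⟩
    have hs' := (Finsupp.mem_supported 𝕜 x).1 hx.1 hs
    refine ⟨(h.mem_sublevel_iff ?_ t).1 hs'.1, hs'.2⟩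
    rintro rfl
    exact Finsupp.mem_support_iff.1 hs h0

theorem finiteDimensional_cycles_sublevel (F : Filtration V) (k : ℕ) (t : ℝ) :
    FiniteDimensional 𝕜 (cycles 𝕜 (F.sublevel t) k) :=
  finiteDimensional_cycles _ (F.finite_sublevel t) k

open Classical in
/-- The addition of one simplex adds at most one dimension to the cycles: those that avoid the new
simplex are the kernel of one coordinate functional. -/
theorem Filtration.IsAddition.finrank_cycles (h : F.IsAddition σ F') (k : ℕ) (t : ℝ) :
    finrank 𝕜 (cycles 𝕜 (F'.sublevel t) k) = finrank 𝕜 (cycles 𝕜 (F.sublevel t) k) +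
      if ¬ cycles 𝕜 (F'.sublevel t) k ≤ cycles 𝕜 (F.sublevel t) k then 1 else 0 := by
  have := finiteDimensional_cycles_sublevel 𝕜 F' k t
  have hle := cycles_mono (𝕜 := 𝕜) (h.sublevel_le t) k
  have hinf : cycles 𝕜 (F'.sublevel t) k ⊓ LinearMap.ker (Finsupp.lapply σ) =
      cycles 𝕜 (F.sublevel t) k := Submodule.ext fun x => (h.mem_cycles_iff 𝕜 k t x).symm
  by_cases hc : cycles 𝕜 (F'.sublevel t) k ≤ cycles 𝕜 (F.sublevel t) k
  · rw [if_neg (not_not.2 hc), add_zero, le_antisymm hc hle]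
  · rw [if_pos hc]
    have := finrank_inf_ker_add_one (cycles 𝕜 (F'.sublevel t) k) (Finsupp.lapply σ)
      fun h' => hc (by rw [← hinf]; exact le_inf le_rfl h')
    rw [hinf] at this
    exact this.symm

end Addition

/-- The rank function of any barcode of persistent homology, in terms of cycles and
boundaries. -/
theorem rankCount_add_finrank {𝕜 : Type u} [Field 𝕜] {V : Type v} [LinearOrder V]
    {F : Filtration V} {k n : ℕ} {b : Fin n → ℝ} {d : Fin n → EReal}
    (e : (persistentHomology 𝕜 F k).Iso
      (PersistenceModule.directSum fun i => intervalModule 𝕜 (b i) (d i)))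
    {a t : ℝ} (h : a ≤ t) :
    rankCount b d a t +
      finrank 𝕜 ↥(cycles 𝕜 (F.sublevel a) k ⊓ boundaries 𝕜 (F.sublevel t) k) =
      finrank 𝕜 (cycles 𝕜 (F.sublevel a) k) := by
  rw [← finrank_range_directSum_intervalModule (𝕜 := 𝕜) b d h, ← e.finrank_range_map_eq h]
  exact finrank_range_homologyMap_add (F.sublevel_mono h) (F.finite_sublevel a) k

end PersistentCycles

open PersistentCycles in
theorem lemma6p2 {𝕜 : Type*} [Field 𝕜] {V : Type*} [LinearOrder V]
    (F F' : Filtration V) (σ : Finset V) (hσ : F.IsAddition σ F')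
    (k : ℕ) (α : ℝ) (hα : 1 < α) :
    (∃ D, IsDiagram (persistentHomology 𝕜 F k) D) ∧
    (∃ D', IsDiagram (persistentHomology 𝕜 F' k) D') ∧
    ∀ D D' : Multiset (ℝ × EReal),
      IsDiagram (persistentHomology 𝕜 F k) D →
      IsDiagram (persistentHomology 𝕜 F' k) D' →
      ((simplexDim σ = k ∨ simplexDim σ = k + 1) →
        (persistentCount α D : ℤ) - 1 ≤ persistentCount α D' ∧
        (persistentCount α D' : ℤ) ≤ persistentCount α D + 1) ∧
      (¬ (simplexDim σ = k ∨ simplexDim σ = k + 1) →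
        persistentCount α D' = persistentCount α D) := by
  classical
  refine ⟨exists_isDiagram 𝕜 F k, exists_isDiagram 𝕜 F' k, ?_⟩
  rintro _ _ ⟨n, b, d, hbd, ⟨e⟩, rfl⟩ ⟨n', b', d', hbd', ⟨e'⟩, rfl⟩
  have hr := fun {a t : ℝ} (h : a ≤ t) => rankCount_add_finrank e h
  have hr' := fun {a t : ℝ} (h : a ≤ t) => rankCount_add_finrank e' h
  -- If `dim σ = k + 1`, the boundary of `σ` joins the boundaries, and the rank drops exactly when
  -- some cycle of the source becomes a boundary through it.
  by_cases hk2 : σ.card = k + 2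
  · set y := boundary 𝕜 (Finsupp.single σ 1)
    set Z := fun t => cycles 𝕜 (F.sublevel t) k
    set B := fun t => boundaries 𝕜 (F.sublevel t) k
    set B' := fun t => boundaries 𝕜 (F'.sublevel t) k
    have hZ : ∀ t, cycles 𝕜 (F'.sublevel t) k = Z t := hσ.cycles_eq 𝕜 (by omega)
    have hZmono : Monotone Z := fun _ _ h => cycles_mono (F.sublevel_mono h) k
    have hBmono : Monotone B := fun _ _ h => boundaries_mono (F.sublevel_mono h) k
    have hBB' : ∀ t, B t ≤ B' t := fun t => boundaries_mono (hσ.sublevel_le t) k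
    have hBy : ∀ t, B' t ≤ B t ⊔ Submodule.span 𝕜 {y} := fun t => by
      refine (hσ.boundaries_eq_sup 𝕜 hk2 t).le.trans (sup_le_sup_left ?_ _)
      split_ifs
      exacts [le_rfl, bot_le]
    obtain ⟨h1, h2⟩ := persistentCount_of_rankCount hbd hbd'
      (fun a t => ¬ Z a ⊓ B' t ≤ B t)
      (fun a a' t haa' _ hP hP' => hP ((inf_le_inf_right _ (hZmono haa')).trans hP'))
      (by
        intro a a' a'' t t' haa' _ _ htt' _ h1 h2 h3
        obtain ⟨z, hz, hzB⟩ := SetLike.not_le_iff_exists.1 h1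
        -- The witness `z` can replace `y`, so if it is a boundary at `t'` already without `σ`,
        -- then `σ` adds nothing to the boundaries at `t'`.
        have hB'mono : B' t ≤ B' t' := boundaries_mono (F'.sublevel_mono htt') k
        have hzB' : z ∈ B t' := h3 ⟨hZmono haa' hz.1, hB'mono hz.2⟩
        have hy : y ∈ B t' :=
          (sup_le (hBmono htt') ((Submodule.span_singleton_le_iff_mem _ _).2 hzB'))
            (mem_sup_span_singleton_exchange (hBy t hz.2) hzB)
        exact h2 (inf_le_right.trans ((hBy t').trans
          (sup_le le_rfl ((Submodule.span_singleton_le_iff_mem _ _).2 hy)))))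
      (by
        intro a t hat
        have := finiteDimensional_cycles_sublevel 𝕜 F k a
        have e1 := hr hat
        have e2 := hr' hat
        have e3 := finrank_inf_eq_add (Z := Z a) (hBB' t) (hBy t)
        rw [hZ a] at e2
        change _ + Module.finrank 𝕜 ↥(Z a ⊓ B t) = Module.finrank 𝕜 (Z a) at e1
        change _ + Module.finrank 𝕜 ↥(Z a ⊓ B' t) = _ at e2
        split_ifs at e3 ⊢ <;> omega)
      hα
    refine ⟨fun _ => by omega, fun h => absurd (Or.inr ?_) h⟩
    rw [simplexDim, hk2]
    push_cast
    ring
  · have hB : ∀ t, boundaries 𝕜 (F'.sublevel t) k = boundaries 𝕜 (F.sublevel t) k :=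
      hσ.boundaries_eq 𝕜 hk2
    -- If `dim σ = k`, the only change is at most one additional cycle.
    by_cases hk1 : σ.card = k + 1
    · obtain ⟨h1, h2⟩ := persistentCount_of_rankCount hbd' hbd
        (fun a _ => ¬ cycles 𝕜 (F'.sublevel a) k ≤ cycles 𝕜 (F.sublevel a) k)
        (by
          intro a a' _ haa' _ hP hP'
          refine hP fun x hx => (hσ.mem_cycles_iff 𝕜 k a x).2 ⟨hx, ?_⟩
          exact ((hσ.mem_cycles_iff 𝕜 k a' x).1
            (hP' (cycles_mono (F'.sublevel_mono haa') k hx))).2)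
        (by
          intro a a' _ _ _ haa' _ _ _ _ hP _ hP'
          refine hP fun x hx => (hσ.mem_cycles_iff 𝕜 k a x).2 ⟨hx, ?_⟩
          exact ((hσ.mem_cycles_iff 𝕜 k a' x).1
            (hP' (cycles_mono (F'.sublevel_mono haa') k hx))).2)
        (by
          intro a t hat
          have e1 := hr hat
          have e2 := hr' hat
          have e3 := hσ.finrank_cycles 𝕜 k a
          -- Boundaries do not involve `σ`, so new cycles do not become boundaries.
          have e4 : cycles 𝕜 (F'.sublevel a) k ⊓ boundaries 𝕜 (F'.sublevel t) k =
              cycles 𝕜 (F.sublevel a) k ⊓ boundaries 𝕜 (F.sublevel t) k := by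
            rw [hB]
            refine le_antisymm (fun x hx => ⟨(hσ.mem_cycles_iff 𝕜 k a x).2 ⟨hx.1, ?_⟩, hx.2⟩)
              (inf_le_inf_right _ (cycles_mono (hσ.sublevel_le a) k))
            exact ((hσ.mem_cycles_iff 𝕜 k t x).1 (boundaries_le_cycles _ k hx.2)).2
          rw [e4] at e2
          split_ifs at e3 ⊢ <;> omega)
        hα
      refine ⟨fun _ => by omega, fun h => absurd (Or.inl ?_) h⟩
      rw [simplexDim, hk1]
      push_cast
      ring
    · have heq : ∀ a t, a ≤ t → rankCount b d a t = rankCount b' d' a t := by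
        intro a t hat
        have e1 := hr hat
        have e2 := hr' hat
        rw [hB, hσ.cycles_eq 𝕜 hk1] at e2
        omega
      obtain ⟨h1, -⟩ := persistentCount_of_rankCount hbd hbd' (fun _ _ => False)
        (fun _ _ _ _ _ h => h) (fun _ _ _ _ _ _ _ _ _ _ h _ => h)
        (fun a t h => by simp [heq a t h]) hα
      obtain ⟨h2, -⟩ := persistentCount_of_rankCount hbd' hbd (fun _ _ => False)
        (fun _ _ _ _ _ h => h) (fun _ _ _ _ _ _ _ _ _ _ h _ => h)
        (fun a t h => by simp [heq a t h]) hα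
      refine ⟨fun h => ?_, fun _ => le_antisymm h1 h2⟩
      unfold simplexDim at h
      omega
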